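/- Let $n\ge 1$, let $M(n)$ be the space of complex $n\times n$ matrices and $P(n)$ the algebra of polynomial functions on $M(n)$, with coordinate functions $\alpha_{ij}(x)=x_{ij}$. Equip $P(n)$ with the Poisson bracket that is the biderivation determined by $$[\alpha_{ij},\alpha_{st}]=\delta_{js}\,\alpha_{it}-\delta_{it}\,\alpha_{sj}$$ (equivalently, the Poisson bracket of the symmetric algebra of the Lie algebra $M(n)$, carried over to $P(n)$ by $u\mapsto(x\mapsto-\operatorname{tr}(ux))$). For $1\le m\le n$ let $P(m)^{Gl(m)}\subset P(m)$ be the algebra of polynomial functions on $M(m)$ that are invariant under conjugation by $Gl(m)$, and regard $P(m)$ as a subalgebra of $P(n)$ by composing with the map $x\mapsto x_m$ that sends $x\in M(n)$ to its upper left $m\times m$ block. Let $J(n)\subset P(n)$ be the $\mathbb C$-subalgebra generated by $P(m)^{Gl(m)}$ for $m=1,\dots,n$. Then $J(n)$ is a polynomial ring in $n(n+1)/2$ generators (that is, it is generated by $n(n+1)/2$ algebraically independent elements), and $J(n)$ is a maximal Poisson commutative subalgebra of $P(n)$: one has $[p,q]=0$ for all $p,q\in J(n)$, and every subalgebra of $P(n)$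 that contains $J(n)$ and on which the bracket vanishes identically equals $J(n)$. -/

import Mathlib

open scoped Matrix

noncomputable section

namespace GelfandZeitlin

/-- The algebra `P(n)` of polynomial functions on the space `M(n)` of complex `n × n` matrices; the
variable `X (i, j)` is the coordinate function `α i j : x ↦ x i j`. -/
abbrev P (n : ℕ) : Type := MvPolynomial (Fin n × Fin n) ℂ

/-- The value `p(x)` of a polynomial function `p ∈ P(n)` at a matrix `x ∈ M(n)`. -/
def value {n : ℕ} (p : P n) (x : Matrix (Fin n) (Fin n) ℂ) : ℂ :=
  MvPolynomial.eval (fun a : Fin n × Fin n => x a.1 a.2) p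

/-- The Poisson bracket of two coordinate functions,
`[α i j, α s t] = δ_{j s} α i t - δ_{i t} α s j`. It is the commutator of `M(n)` carried over to
linear functions by `γ : u ↦ (x ↦ -tr (u x))`, for which `α i j = γ (-e_{j i})`. -/
def coordBracket {n : ℕ} (a b : Fin n × Fin n) : P n :=
  (if a.2 = b.1 then MvPolynomial.X (a.1, b.2) else 0) -
    (if a.1 = b.2 then MvPolynomial.X (b.1, a.2) else 0)

/-- The Poisson bracket on `P(n)`: the biderivation that extends the bracket of the coordinate
functions, `[p, q] = ∑ ∂p/∂α_a · ∂q/∂α_b · [α_a, α_b]`. -/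
def poisson {n : ℕ} (p q : P n) : P n :=
  ∑ a : Fin n × Fin n, ∑ b : Fin n × Fin n,
    MvPolynomial.pderiv a p * MvPolynomial.pderiv b q * coordBracket a b

/-- The algebra `P(m)^{Gl(m)}` of polynomial functions on `M(m)` that are invariant under
conjugation by `Gl(m)`. -/
def invariants (m : ℕ) : Subalgebra ℂ (P m) where
  carrier := {p | ∀ (g : GL (Fin m) ℂ) (x : Matrix (Fin m) (Fin m) ℂ),
    value p ((g : Matrix (Fin m) (Fin m) ℂ) * x *
      ((g⁻¹ : GL (Fin m) ℂ) : Matrix (Fin m) (Fin m) ℂ)) = value p x}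
  mul_mem' := by
    intro p q hp hq g x
    have h1 := hp g x
    have h2 := hq g x
    simp only [value, map_mul] at h1 h2 ⊢
    rw [h1, h2]
  add_mem' := by
    intro p q hp hq g x
    have h1 := hp g x
    have h2 := hq g x
    simp only [value, map_add] at h1 h2 ⊢
    rw [h1, h2]
  algebraMap_mem' := by
    intro c g x
    simp [value, MvPolynomial.algebraMap_eq]

/-- The embedding `P(m) → P(n)` for `m ≤ n`: composition of a polynomial function on `M(m)` with
the map `x ↦ x_m` that sends a matrix to its upper left `m × m` block. -/
def embed {m n : ℕ} (h : m ≤ n) : P m →ₐ[ℂ] P n :=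
  MvPolynomial.rename (Prod.map (Fin.castLE h) (Fin.castLE h))

/-- The algebra `J(n)`: the subalgebra of `P(n)` generated by the (embedded) algebras
`P(m)^{Gl(m)}`, `1 ≤ m ≤ n`. -/
def J (n : ℕ) : Subalgebra ℂ (P n) :=
  ⨆ (m : ℕ) (_ : 1 ≤ m) (h : m ≤ n), (invariants m).map (embed h)

/-- A subalgebra of `P(n)` is Poisson commutative if the bracket of any two of its elements
vanishes. -/
def IsPoissonCommutative {n : ℕ} (A : Subalgebra ℂ (P n)) : Prop :=
  ∀ p ∈ A, ∀ q ∈ A, poisson p q = 0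

end GelfandZeitlin

end

/-!
The algebra `J n` is compared with the polynomial ring of functions on the affine space of upper
Hessenberg matrices: the matrices with ones on the subdiagonal, zeros below it and arbitrary entries
on and above the diagonal. This space has dimension `n (n + 1) / 2`.

The coefficients of the characteristic polynomials of the leading blocks `x_m` lie in `J n`, and
they restrict to a coordinate system on the Hessenberg matrices. Indeed the characteristic
polynomials of the blocks satisfy a recursion (`charpoly_block_succ`), from which the entries of the
matrix can be recovered polynomially (`mem_of_charpoly_coeff_mem`). So these `n (n + 1) / 2`
elements generate the coordinate ring of the Hessenberg matrices (`adjoin_restrict_blockCoeff`), and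
are algebraically independent for reasons of transcendence degree.

`J n` is Poisson commutative (`isPoissonCommutative_J`) because an invariant `p` of `M(m)` Poisson
commutes with all functions on `M(m)`: the bracket is the derivative of `p` along a commutator
`[x, u]` (`value_poisson`, `dirDeriv_invariant`).

Conversely, let `f` Poisson commute with `J n`. The Hamiltonian vector fields of the functions
`tr (x_m ^ k)` are the commutators with the powers of `x_m`, padded by zeros, so `f` is invariant under
conjugation of `x` by the invertible polynomials in `x_m`, extended by the identity
(`value_conj_eq`). Such conjugations, for increasing `m`, bring a generic matrix into Hessenberg
form: if `x_m` is a Hessenberg matrix and the first `m` entries of the row of `x` below `x_m` form a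
row vector `c` that is cyclic for `x_m`, then some invertible polynomial in `x_m` carries `c` to
`(0, …, 0, 1)` (`exists_aeval_vecMul_eq_lastRow`). Hence `f` is determined by its restriction to the
Hessenberg matrices (`eq_zero_of_value_hessenberg`). That restriction is also the restriction of a
polynomial `g` in the characteristic coefficients, and `f - g` Poisson commutes with `J n` too, so
`f = g` (`mem_adjoin_of_poisson_eq_zero`).

Applied to `f ∈ J n`, the last conclusion shows that the characteristic coefficients generate `J n`;
no separate description of the invariants of `Gl(m)` is needed. Applied to an element of a Poisson
commutative subalgebra that contains `J n`, it gives maximality.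
-/

noncomputable section

namespace GelfandZeitlin

/-! ### Blocks, directional derivatives and the Poisson bracket -/

/-- The `n × m` matrix of the inclusion of the first `m` coordinates. With `E = incl h`, the upper
left block of `x` is `Eᵀ * x * E`, and `E * y * Eᵀ` is `y` padded by zeros. -/
def incl {m n : ℕ} (h : m ≤ n) : Matrix (Fin n) (Fin m) ℂ :=
  (1 : Matrix (Fin n) (Fin n) ℂ).submatrix id (Fin.castLE h)

/-- The upper left `m × m` block `x_m` of a matrix `x`. -/
def block {R : Type*} {m n : ℕ} (h : m ≤ n) (x : Matrix (Fin n) (Fin n) R) :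
    Matrix (Fin m) (Fin m) R :=
  x.submatrix (Fin.castLE h) (Fin.castLE h)

theorem mul_incl {l : Type*} {m n : ℕ} (h : m ≤ n) (x : Matrix l (Fin n) ℂ) :
    x * incl h = x.submatrix id (Fin.castLE h) := by
  ext i j
  simp [incl, Matrix.mul_apply, Matrix.one_apply]

theorem inclT_mul {l : Type*} {m n : ℕ} (h : m ≤ n) (x : Matrix (Fin n) l ℂ) :
    (incl h)ᵀ * x = x.submatrix (Fin.castLE h) id := by
  ext i j
  simp [incl, Matrix.mul_apply, Matrix.one_apply]

theorem inclT_mul_incl {m n : ℕ} (h : m ≤ n) : (incl h)ᵀ * incl h = 1 := by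
  rw [inclT_mul]
  ext i j
  simp [incl, Matrix.one_apply]

theorem inclT_mul_mul_incl {m n : ℕ} (h : m ≤ n) (x : Matrix (Fin n) (Fin n) ℂ) :
    (incl h)ᵀ * x * incl h = block h x := by
  rw [mul_incl, inclT_mul]
  rfl

theorem value_embed {m n : ℕ} (h : m ≤ n) (p : P m) (x : Matrix (Fin n) (Fin n) ℂ) :
    value (embed h p) x = value p (block h x) := by
  simp only [value, embed, MvPolynomial.eval_rename]
  rfl

/-- Polynomials are determined by their values on matrices. -/
theorem eq_of_value {n : ℕ} {p q : P n} (h : ∀ x, value p x = value q x) : p = q := by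
  refine MvPolynomial.funext fun x => ?_
  simpa [value] using h (Matrix.of fun i j => x (i, j))

/-- The matrix of partial derivatives of `p` at `x`. -/
def grad {n : ℕ} (p : P n) (x : Matrix (Fin n) (Fin n) ℂ) : Matrix (Fin n) (Fin n) ℂ :=
  Matrix.of fun i j => value (MvPolynomial.pderiv (i, j) p) x

/-- The derivative of `p` at `x` in the direction `v`. -/
def dirDeriv {n : ℕ} (p : P n) (x v : Matrix (Fin n) (Fin n) ℂ) : ℂ :=
  ∑ i, ∑ j, grad p x i j * v i j

theorem dirDeriv_add_right {n : ℕ} (p : P n) (x v w : Matrix (Fin n) (Fin n) ℂ) :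
    dirDeriv p x (v + w) = dirDeriv p x v + dirDeriv p x w := by
  simp [dirDeriv, mul_add, Finset.sum_add_distrib]

theorem dirDeriv_smul_right {n : ℕ} (p : P n) (x v : Matrix (Fin n) (Fin n) ℂ) (c : ℂ) :
    dirDeriv p x (c • v) = c * dirDeriv p x v := by
  simp only [dirDeriv, Matrix.smul_apply, smul_eq_mul, Finset.mul_sum]
  exact Finset.sum_congr rfl fun i _ => Finset.sum_congr rfl fun j _ => by ring

theorem dirDeriv_add_left {n : ℕ} (p q : P n) (x v : Matrix (Fin n) (Fin n) ℂ) :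
    dirDeriv (p + q) x v = dirDeriv p x v + dirDeriv q x v := by
  simp [dirDeriv, grad, value, add_mul, Finset.sum_add_distrib]

theorem dirDeriv_mul_left {n : ℕ} (p q : P n) (x v : Matrix (Fin n) (Fin n) ℂ) :
    dirDeriv (p * q) x v = value p x * dirDeriv q x v + value q x * dirDeriv p x v := by
  simp only [dirDeriv, grad, value, Matrix.of_apply, Derivation.leibniz, smul_eq_mul, map_add,
    map_mul, Finset.mul_sum, ← Finset.sum_add_distrib]
  exact Finset.sum_congr rfl fun i _ => Finset.sum_congr rfl fun j _ => by ring

theorem dirDeriv_C {n : ℕ} (c : ℂ) (x v : Matrix (Fin n) (Fin n) ℂ) :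
    dirDeriv (MvPolynomial.C c) x v = 0 := by
  simp [dirDeriv, grad, value]

theorem dirDeriv_X {n : ℕ} (a : Fin n × Fin n) (x v : Matrix (Fin n) (Fin n) ℂ) :
    dirDeriv (MvPolynomial.X a) x v = v a.1 a.2 := by
  have h : ∀ i j, grad (MvPolynomial.X a) x i j * v i j
      = if i = a.1 then (if j = a.2 then v i j else 0) else 0 := by
    intro i j
    by_cases hi : i = a.1 <;> by_cases hj : j = a.2 <;>
      simp [grad, value, MvPolynomial.pderiv_X, Pi.single_apply, Prod.ext_iff, hi, hj, eq_comm]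
  simp [dirDeriv, h]

theorem dirDeriv_single {n : ℕ} (p : P n) (x : Matrix (Fin n) (Fin n) ℂ) (i j : Fin n) :
    dirDeriv p x (Matrix.single i j 1) = grad p x i j := by
  simp [dirDeriv, Matrix.single_apply, ite_and]

/-- The chain rule along a curve of matrices. -/
theorem hasDerivAt_value {n : ℕ} (p : P n) {γ : ℂ → Matrix (Fin n) (Fin n) ℂ}
    {v : Matrix (Fin n) (Fin n) ℂ} {s : ℂ}
    (h : ∀ i j, HasDerivAt (fun t => γ t i j) (v i j) s) :
    HasDerivAt (fun t => value p (γ t)) (dirDeriv p (γ s) v) s := by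
  induction p using MvPolynomial.induction_on with
  | C c => simpa [dirDeriv_C, value] using hasDerivAt_const s c
  | add p q hp hq =>
    rw [dirDeriv_add_left]
    simpa [value] using hp.fun_add hq
  | mul_X p a hp =>
    rw [dirDeriv_mul_left, dirDeriv_X]
    have := hp.fun_mul (h a.1 a.2)
    simp only [value, map_mul, MvPolynomial.eval_X] at this ⊢
    convert! this using 1
    all_goals ring

theorem hasDerivAt_line {n : ℕ} (x v : Matrix (Fin n) (Fin n) ℂ) (i j : Fin n) (s : ℂ) :
    HasDerivAt (fun t : ℂ => (x + t • v) i j) (v i j) s := by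
  simpa using ((hasDerivAt_id s).mul_const (v i j)).const_add (x i j)

theorem dirDeriv_embed {m n : ℕ} (h : m ≤ n) (p : P m) (x v : Matrix (Fin n) (Fin n) ℂ) :
    dirDeriv (embed h p) x v = dirDeriv p (block h x) (block h v) := by
  have h1 := hasDerivAt_value (embed h p) (fun i j => hasDerivAt_line x v i j 0)
  have h2 := hasDerivAt_value p (fun i j => hasDerivAt_line (block h x) (block h v) i j 0)
  simp only [zero_smul, add_zero] at h1 h2
  refine h1.unique (h2.congr_of_eventuallyEq (.of_forall fun t => ?_))
  simp only [value_embed]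
  rfl

theorem grad_embed {m n : ℕ} (h : m ≤ n) (p : P m) (x : Matrix (Fin n) (Fin n) ℂ) :
    grad (embed h p) x = incl h * grad p (block h x) * (incl h)ᵀ := by
  ext i j
  have hs : ∀ a b, block h (Matrix.single i j (1 : ℂ)) a b = incl h i a * incl h j b := by
    intro a b
    by_cases hi : i = Fin.castLE h a <;> by_cases hj : j = Fin.castLE h b <;>
      simp [block, incl, Matrix.one_apply, hi, hj]
  rw [← dirDeriv_single (embed h p), dirDeriv_embed]
  simp only [dirDeriv, hs, Matrix.mul_apply, Matrix.transpose_apply, Finset.sum_mul]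
  rw [Finset.sum_comm]
  exact Finset.sum_congr rfl fun a _ => Finset.sum_congr rfl fun b _ => by ring

/-- The Poisson bracket `[p, q]` is the derivative of `p` along the commutator of `x` with the
transposed gradient of `q`. -/
theorem value_poisson {n : ℕ} (p q : P n) (x : Matrix (Fin n) (Fin n) ℂ) :
    value (poisson p q) x = dirDeriv p x (x * (grad q x)ᵀ - (grad q x)ᵀ * x) := by
  have hcb : ∀ i j s t : Fin n, value (coordBracket (i, j) (s, t)) x =
      (if j = s then x i t else 0) - (if i = t then x s j else 0) := by
    intro i j s t
    simp only [value, coordBracket, map_sub]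
    split_ifs <;> simp
  have hv : value (poisson p q) x = ∑ i, ∑ j, ∑ s, ∑ t, grad p x i j * grad q x s t *
      ((if j = s then x i t else 0) - (if i = t then x s j else 0)) := by
    simp only [← hcb]
    simp only [value, poisson, map_sum, map_mul, Fintype.sum_prod_type]
    rfl
  rw [hv]
  refine Finset.sum_congr rfl fun i _ => Finset.sum_congr rfl fun j _ => ?_
  simp only [Matrix.sub_apply, Matrix.mul_apply, Matrix.transpose_apply, mul_sub,
    Finset.sum_sub_distrib, Finset.mul_sum, mul_ite, mul_zero]
  congr 1
  · rw [Finset.sum_comm]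
    refine Finset.sum_congr rfl fun t _ => ?_
    simp only [Finset.sum_ite_eq, Finset.mem_univ, if_true]
    ring
  · refine Finset.sum_congr rfl fun s _ => ?_
    simp only [Finset.sum_ite_eq, Finset.mem_univ, if_true]
    ring

theorem poisson_swap {n : ℕ} (p q : P n) : poisson q p = -poisson p q := by
  have h : ∀ a b : Fin n × Fin n, coordBracket b a = -coordBracket a b := by
    intro a b
    simp only [coordBracket, neg_sub, eq_comm]
  rw [poisson, Finset.sum_comm, poisson, ← Finset.sum_neg_distrib]
  refine Finset.sum_congr rfl fun a _ => ?_
  rw [← Finset.sum_neg_distrib]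
  refine Finset.sum_congr rfl fun b _ => ?_
  rw [h a b]
  ring

/-! ### Poisson commutativity of `J n` -/

/-- The elements that Poisson commute with `q` form a subalgebra. -/
def commutant {n : ℕ} (q : P n) : Subalgebra ℂ (P n) where
  carrier := {p | poisson p q = 0}
  mul_mem' := by
    intro a b ha hb
    refine eq_of_value fun x => ?_
    have h1 := value_poisson a q x
    have h2 := value_poisson b q x
    rw [show poisson a q = 0 from ha] at h1
    rw [show poisson b q = 0 from hb] at h2
    rw [value_poisson, dirDeriv_mul_left, ← h1, ← h2]
    simp [value]
  add_mem' := by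
    intro a b ha hb
    refine eq_of_value fun x => ?_
    rw [value_poisson, dirDeriv_add_left, ← value_poisson, ← value_poisson,
      show poisson a q = 0 from ha, show poisson b q = 0 from hb]
    simp [value]
  algebraMap_mem' := by
    intro c
    refine eq_of_value fun x => ?_
    rw [value_poisson, MvPolynomial.algebraMap_eq, dirDeriv_C]
    simp [value]

theorem mem_commutant {n : ℕ} {p q : P n} : p ∈ commutant q ↔ poisson p q = 0 := Iff.rfl

theorem mem_commutant_comm {n : ℕ} {p q : P n} : p ∈ commutant q ↔ q ∈ commutant p := by
  rw [mem_commutant, mem_commutant, poisson_swap p q, neg_eq_zero]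

/-- An invariant polynomial is infinitesimally invariant. Invariance amounts to
`p (g * x) = p (x * g)` for invertible `g`; the claim is its derivative at `g = 1`. -/
theorem dirDeriv_invariant {m : ℕ} {p : P m} (hp : p ∈ invariants m)
    (x u : Matrix (Fin m) (Fin m) ℂ) : dirDeriv p x (x * u - u * x) = 0 := by
  have key : ∀ g : Matrix (Fin m) (Fin m) ℂ, g.det ≠ 0 → value p (g * x) = value p (x * g) := by
    intro g hg
    have := hp (Matrix.GeneralLinearGroup.mkOfDetNeZero g hg) (x * g)
    rw [← this]
    congr 1
    have hgg : g * (((Matrix.GeneralLinearGroup.mkOfDetNeZero g hg)⁻¹ : GL (Fin m) ℂ) :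
        Matrix (Fin m) (Fin m) ℂ) = 1 :=
      (Matrix.GeneralLinearGroup.mkOfDetNeZero g hg).mul_inv
    change g * x = g * (x * g) * _
    rw [mul_assoc, mul_assoc, hgg, mul_one]
  have h1 := hasDerivAt_value p (fun i j => hasDerivAt_line x (u * x) i j 0)
  have h2 := hasDerivAt_value p (fun i j => hasDerivAt_line x (x * u) i j 0)
  simp only [zero_smul, add_zero] at h1 h2
  have hcont : Continuous fun t : ℂ => (1 + t • u : Matrix (Fin m) (Fin m) ℂ).det := by
    fun_prop
  have hne : ∀ᶠ t in nhds (0 : ℂ), (1 + t • u : Matrix (Fin m) (Fin m) ℂ).det ≠ 0 :=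
    hcont.continuousAt.eventually_ne (by simp)
  have h3 : dirDeriv p x (x * u) = dirDeriv p x (u * x) := by
    refine h2.unique (h1.congr_of_eventuallyEq ?_)
    filter_upwards [hne] with t ht
    have := key _ ht
    rw [add_mul, mul_add, one_mul, mul_one, smul_mul_assoc, mul_smul_comm] at this
    exact this.symm
  have h4 := dirDeriv_add_right p x (x * u - u * x) (u * x)
  rw [sub_add_cancel, h3] at h4
  simpa using h4

theorem poisson_embed_of_invariant {m n : ℕ} (h : m ≤ n) {p : P m} (hp : p ∈ invariants m)
    (q : P m) : poisson (embed h p) (embed h q) = 0 := by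
  refine eq_of_value fun x => ?_
  have hE := inclT_mul_incl h
  have : block h (x * (incl h * grad q (block h x) * (incl h)ᵀ)ᵀ -
      (incl h * grad q (block h x) * (incl h)ᵀ)ᵀ * x) =
      block h x * (grad q (block h x))ᵀ - (grad q (block h x))ᵀ * block h x := by
    generalize grad q (block h x) = N
    simp only [← inclT_mul_mul_incl, Matrix.transpose_mul, Matrix.transpose_transpose,
      Matrix.mul_sub, Matrix.sub_mul, Matrix.mul_assoc, hE, Matrix.mul_one]
    congr 1
    rw [← Matrix.mul_assoc, hE, Matrix.one_mul]
  rw [value_poisson, dirDeriv_embed, grad_embed, this, dirDeriv_invariant hp]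
  simp [value]

theorem embed_embed {l m n : ℕ} (h : l ≤ m) (h' : m ≤ n) (p : P l) :
    embed h' (embed h p) = embed (h.trans h') p := by
  simp only [embed, MvPolynomial.rename_rename]
  rfl

theorem embed_mem_J {m n : ℕ} (hm : 1 ≤ m) (h : m ≤ n) {p : P m} (hp : p ∈ invariants m) :
    embed h p ∈ J n := by
  have : (invariants m).map (embed h) ≤ J n :=
    le_iSup_of_le m (le_iSup_of_le hm (le_iSup_of_le h le_rfl))
  exact this ⟨p, hp, rfl⟩

theorem J_le_iff {n : ℕ} {A : Subalgebra ℂ (P n)} : J n ≤ A ↔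
    ∀ (m : ℕ) (_ : 1 ≤ m) (h : m ≤ n) (p : P m), p ∈ invariants m → embed h p ∈ A := by
  constructor
  · exact fun hA m hm h p hp => hA (embed_mem_J hm h hp)
  · intro hA
    refine iSup_le fun m => iSup_le fun hm => iSup_le fun h => ?_
    rintro _ ⟨p, hp, rfl⟩
    exact hA m hm h p hp

/-- Of two generators of `J n`, the one with the larger block size is invariant on that block, while
the other one is a function on the same block. -/
theorem isPoissonCommutative_J (n : ℕ) : IsPoissonCommutative (J n) := by
  have h1 : ∀ (m : ℕ) (h : m ≤ n) (p : P m) (l : ℕ) (h' : l ≤ n) (q : P l), p ∈ invariants m →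
      l ≤ m → embed h p ∈ commutant (embed h' q) := by
    intro m h p l h' q hp hlm
    rw [mem_commutant, ← embed_embed hlm h]
    exact poisson_embed_of_invariant h hp _
  have h2 : ∀ (l : ℕ) (_ : 1 ≤ l) (h' : l ≤ n) (q : P l), q ∈ invariants l →
      J n ≤ commutant (embed h' q) := by
    intro l _ h' q hq
    refine J_le_iff.2 fun m _ h p hp => ?_
    rcases le_total l m with hlm | hml
    · exact h1 m h p l h' q hp hlm
    · exact mem_commutant_comm.1 (h1 l h' q m h p hq hml)
  intro p hp q hq
  have h3 : J n ≤ commutant p :=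
    J_le_iff.2 fun m hm h q hq => mem_commutant_comm.1 (h2 m hm h q hq hp)
  exact mem_commutant_comm.1 (h3 hq)

/-! ### Characteristic coefficients and power traces -/

theorem map_mvPolynomialX {n : ℕ} (x : Matrix (Fin n) (Fin n) ℂ) :
    (MvPolynomial.eval fun a : Fin n × Fin n => x a.1 a.2).mapMatrix
      (Matrix.mvPolynomialX (Fin n) (Fin n) ℂ) = x :=
  Matrix.mvPolynomialX_mapMatrix_eval x

/-- The `k`-th coefficient of the characteristic polynomial, as a polynomial function. -/
def charCoeff (m k : ℕ) : P m :=
  (Matrix.mvPolynomialX (Fin m) (Fin m) ℂ).charpoly.coeff k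

theorem value_charCoeff {m : ℕ} (k : ℕ) (x : Matrix (Fin m) (Fin m) ℂ) :
    value (charCoeff m k) x = x.charpoly.coeff k := by
  conv_rhs => rw [← map_mvPolynomialX x, RingHom.mapMatrix_apply, Matrix.charpoly_map,
    Polynomial.coeff_map]
  rfl

theorem charCoeff_mem_invariants (m k : ℕ) : charCoeff m k ∈ invariants m := by
  intro g x
  rw [value_charCoeff, value_charCoeff, Matrix.coe_units_inv, Matrix.charpoly_units_conj]

/-- The polynomial function `x ↦ tr (x ^ k)`. -/
def powTrace (m k : ℕ) : P m :=
  ((Matrix.mvPolynomialX (Fin m) (Fin m) ℂ) ^ k).trace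

theorem value_trace {m : ℕ} (y : Matrix (Fin m) (Fin m) (P m)) (x : Matrix (Fin m) (Fin m) ℂ) :
    value y.trace x =
      ((MvPolynomial.eval fun a : Fin m × Fin m => x a.1 a.2).mapMatrix y).trace := by
  simp [value, Matrix.trace]

theorem powTrace_mem_invariants (m k : ℕ) : powTrace m k ∈ invariants m := by
  intro g x
  simp only [powTrace, value_trace, map_pow, map_mvPolynomialX]
  rw [Units.conj_pow, Matrix.trace_units_conj]

/-- The derivative of a power trace. The factor `C`, which commutes with `M`, makes the induction
work. -/
theorem derivation_trace_mul_pow {A : Type*} [CommRing A] [Algebra ℂ A] (D : Derivation ℂ A A)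
    {m : ℕ} (M : Matrix (Fin m) (Fin m) A) (k : ℕ) :
    ∀ C : Matrix (Fin m) (Fin m) A, Commute C M →
    (C * (M ^ (k + 1)).map D).trace = ((k : A) + 1) * (C * M ^ k * M.map D).trace := by
  have hmul : ∀ S T : Matrix (Fin m) (Fin m) A, (S * T).map D = S.map D * T + S * T.map D := by
    intro S T
    ext i j
    simp only [Matrix.map_apply, Matrix.mul_apply, Matrix.add_apply, map_sum, Derivation.leibniz,
      smul_eq_mul, ← Finset.sum_add_distrib]
    exact Finset.sum_congr rfl fun a _ => by ring
  induction k with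
  | zero => simp
  | succ k ih =>
    intro C hC
    have hc : Commute (M * C) M := (Commute.refl M).mul_left hC
    rw [pow_succ, hmul, mul_add, Matrix.trace_add, ← mul_assoc, ← mul_assoc,
      Matrix.trace_mul_comm _ M, ← mul_assoc, ih _ hc, mul_assoc M, (hC.pow_right k).eq,
      ← mul_assoc, ← pow_succ', ← (hC.pow_right (k + 1)).eq]
    push_cast
    ring

theorem grad_powTrace {m : ℕ} (k : ℕ) (x : Matrix (Fin m) (Fin m) ℂ) :
    (grad (powTrace m (k + 1)) x)ᵀ = ((k : ℂ) + 1) • x ^ k := by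
  ext j i
  set ev := (MvPolynomial.eval fun a : Fin m × Fin m => x a.1 a.2) with hev
  set X := Matrix.mvPolynomialX (Fin m) (Fin m) ℂ with hX
  have h1 : MvPolynomial.pderiv (i, j) (powTrace m (k + 1)) =
      ((k : P m) + 1) * (X ^ k * X.map (MvPolynomial.pderiv (i, j))).trace := by
    have := derivation_trace_mul_pow (MvPolynomial.pderiv (R := ℂ) (i, j)) X k 1
      (Commute.one_left _)
    rw [one_mul, one_mul] at this
    rw [← this]
    simp [powTrace, Matrix.trace, X]
  have h2 : X.map (MvPolynomial.pderiv (i, j)) = Matrix.single i j 1 := by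
    ext a b
    by_cases ha : a = i <;> by_cases hb : b = j <;>
      simp [X, MvPolynomial.pderiv_X, Pi.single_apply, Matrix.single_apply, Prod.ext_iff, ha, hb,
        eq_comm]
  have h3 : value (X ^ k * X.map (MvPolynomial.pderiv (i, j))).trace x = (x ^ k) j i := by
    rw [h2, value_trace, map_mul, map_pow, map_mvPolynomialX]
    simp [Matrix.trace_mul_single]
  calc value (MvPolynomial.pderiv (i, j) (powTrace m (k + 1))) x = ((k : ℂ) + 1) * (x ^ k) j i := by
        rw [h1, ← h3]
        simp [value]
    _ = _ := by simp

/-! ### Invariance under the Hamiltonian flows -/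

/-- The Hamiltonian vector fields of the power traces of `x_m` are the commutators of `x` with the
padded powers of `x_m`. -/
theorem dirDeriv_commutator_eq_zero {m n : ℕ} (hm : 1 ≤ m) (h : m ≤ n) {f : P n}
    (hf : ∀ q ∈ J n, poisson f q = 0) (x : Matrix (Fin n) (Fin n) ℂ) (p : Polynomial ℂ) :
    dirDeriv f x (x * (incl h * Polynomial.aeval (block h x) p * (incl h)ᵀ) -
      incl h * Polynomial.aeval (block h x) p * (incl h)ᵀ * x) = 0 := by
  induction p using Polynomial.induction_on' with
  | add p q hp hq =>
    rw [map_add, Matrix.mul_add, Matrix.add_mul, Matrix.mul_add, Matrix.add_mul,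
      add_sub_add_comm, dirDeriv_add_right, hp, hq, add_zero]
  | monomial k c =>
    have h1 := value_poisson f (embed h (powTrace m (k + 1))) x
    rw [hf _ (embed_mem_J hm h (powTrace_mem_invariants m _)), grad_embed, Matrix.transpose_mul,
      Matrix.transpose_mul, Matrix.transpose_transpose, grad_powTrace, Matrix.smul_mul,
      Matrix.mul_smul, Matrix.mul_smul, Matrix.smul_mul, ← smul_sub, dirDeriv_smul_right,
      ← Matrix.mul_assoc (incl h)] at h1
    have h2 := (mul_eq_zero.1 (h1.symm.trans (by simp [value]))).resolve_left
      (Nat.cast_add_one_ne_zero k)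
    rw [Polynomial.aeval_monomial, ← Algebra.smul_def, Matrix.mul_smul, Matrix.smul_mul,
      Matrix.mul_smul, Matrix.smul_mul, ← smul_sub, dirDeriv_smul_right, h2, mul_zero]

/-- The inverse of a matrix is a polynomial in the matrix, by the Cayley-Hamilton theorem. -/
theorem exists_aeval_mul_eq_one {m : ℕ} (g : Matrix (Fin m) (Fin m) ℂ) (hg : g.det ≠ 0) :
    ∃ p : Polynomial ℂ, g * Polynomial.aeval g p = 1 := by
  have h0 : g.charpoly.coeff 0 ≠ 0 := by
    intro h0
    apply hg
    rw [Matrix.det_eq_sign_charpoly_coeff, h0, mul_zero]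
  refine ⟨-Polynomial.C (g.charpoly.coeff 0)⁻¹ * g.charpoly.divX, ?_⟩
  have h1 := Matrix.aeval_self_charpoly g
  rw [← Polynomial.X_mul_divX_add g.charpoly, map_add, map_mul, Polynomial.aeval_X,
    Polynomial.aeval_C] at h1
  rw [map_mul, map_neg, Polynomial.aeval_C, ← mul_assoc, mul_neg, ← Algebra.commutes, neg_mul,
    mul_assoc, eq_neg_of_add_eq_zero_left h1, mul_neg, neg_neg, ← map_mul, inv_mul_cancel₀ h0,
    map_one]

/-- The matrix `w`, extended by the identity from the upper left block to all of `M(n)`. -/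
def extendOne {m n : ℕ} (h : m ≤ n) (w : Matrix (Fin m) (Fin m) ℂ) : Matrix (Fin n) (Fin n) ℂ :=
  1 + incl h * (w - 1) * (incl h)ᵀ

theorem extendOne_one {m n : ℕ} (h : m ≤ n) : extendOne h 1 = 1 := by
  simp [extendOne]

theorem inclT_mul_extendOne {m n : ℕ} (h : m ≤ n) (w : Matrix (Fin m) (Fin m) ℂ) :
    (incl h)ᵀ * extendOne h w = w * (incl h)ᵀ := by
  rw [extendOne, Matrix.mul_add, ← Matrix.mul_assoc, ← Matrix.mul_assoc, inclT_mul_incl,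
    Matrix.one_mul, Matrix.mul_one, Matrix.sub_mul, Matrix.one_mul, add_sub_cancel]

theorem extendOne_mul_incl {m n : ℕ} (h : m ≤ n) (w : Matrix (Fin m) (Fin m) ℂ) :
    extendOne h w * incl h = incl h * w := by
  rw [extendOne, Matrix.add_mul, Matrix.mul_assoc, inclT_mul_incl, Matrix.mul_one, Matrix.mul_sub,
    Matrix.one_mul, Matrix.mul_one, add_sub_cancel]

theorem extendOne_mul {m n : ℕ} (h : m ≤ n) (v w : Matrix (Fin m) (Fin m) ℂ) :
    extendOne h v * extendOne h w = extendOne h (v * w) := by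
  conv_lhs => rw [extendOne, Matrix.add_mul, Matrix.mul_assoc, inclT_mul_extendOne, Matrix.one_mul,
    extendOne]
  rw [extendOne, add_assoc, ← Matrix.mul_assoc, ← Matrix.add_mul, Matrix.mul_assoc,
    ← Matrix.mul_add]
  congr 4
  noncomm_ring

theorem block_conj {m n : ℕ} (h : m ≤ n) (x : Matrix (Fin n) (Fin n) ℂ)
    {v w : Matrix (Fin m) (Fin m) ℂ} (hvw : v * w = 1) (hw : Commute w (block h x)) :
    block h (extendOne h w * x * extendOne h v) = block h x := by
  have h1 : (incl h)ᵀ * (extendOne h w * x * extendOne h v) * incl h =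
      ((incl h)ᵀ * extendOne h w) * x * (extendOne h v * incl h) := by
    simp only [Matrix.mul_assoc]
  have h2 : w * (incl h)ᵀ * x * (incl h * v) = w * ((incl h)ᵀ * x * incl h) * v := by
    simp only [Matrix.mul_assoc]
  rw [← inclT_mul_mul_incl, h1, inclT_mul_extendOne, extendOne_mul_incl, h2, inclT_mul_mul_incl,
    hw.eq, Matrix.mul_assoc, mul_eq_one_comm.1 hvw, Matrix.mul_one]

/-- The points of the line `1 + t • u` are the values of one matrix of polynomials in `t`. -/
theorem exists_matrix_polynomial_line {m : ℕ} (u : Matrix (Fin m) (Fin m) ℂ) :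
    ∃ M : Matrix (Fin m) (Fin m) (Polynomial ℂ),
      (∀ t, (Polynomial.evalRingHom t).mapMatrix M = 1 + t • u) ∧
      ∀ t, (1 + t • u).det = M.det.eval t := by
  have h : ∀ t : ℂ, (Polynomial.evalRingHom t).mapMatrix
      (1 + (Polynomial.X : Polynomial ℂ) • u.map Polynomial.C) = 1 + t • u := by
    intro t
    ext i j
    simp only [RingHom.mapMatrix_apply, Matrix.map_apply, Matrix.add_apply, Matrix.smul_apply,
      Matrix.one_apply, smul_eq_mul, map_add, Polynomial.eval_mul,
      Polynomial.coe_evalRingHom, Polynomial.eval_X,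
      Polynomial.eval_C, apply_ite (Polynomial.eval t), Polynomial.eval_one, Polynomial.eval_zero]
  refine ⟨_, h, fun t => ?_⟩
  rw [← h, ← RingHom.map_det, Polynomial.coe_evalRingHom]

/-- The invertible points of the complex line `1 + t • u` are the complement of a finite set. -/
theorem isOpen_isPreconnected_line {m : ℕ} (u : Matrix (Fin m) (Fin m) ℂ) :
    IsOpen {t : ℂ | (1 + t • u).det ≠ 0} ∧ IsPreconnected {t : ℂ | (1 + t • u).det ≠ 0} := by
  obtain ⟨M, -, hd⟩ := exists_matrix_polynomial_line u
  have hd0 : M.det ≠ 0 := by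
    intro h0
    have := hd 0
    simp [h0] at this
  have hS : {t : ℂ | (1 + t • u).det ≠ 0} = (M.det.rootSet ℂ)ᶜ := by
    ext t
    simp [hd, Polynomial.mem_rootSet, hd0]
  have hfin : (M.det.rootSet ℂ).Finite := M.det.rootSet_finite ℂ
  rw [hS]
  exact ⟨hfin.isClosed.isOpen_compl,
    (hfin.countable.isConnected_compl_of_one_lt_rank (by simp)).isPreconnected⟩

theorem differentiableAt_inv_line {m : ℕ} (u : Matrix (Fin m) (Fin m) ℂ) {s : ℂ}
    (hs : (1 + s • u).det ≠ 0) (i j : Fin m) :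
    DifferentiableAt ℂ (fun t : ℂ => (1 + t • u)⁻¹ i j) s := by
  obtain ⟨M, hM, hd⟩ := exists_matrix_polynomial_line u
  have : (fun t : ℂ => (1 + t • u)⁻¹ i j) =
      fun t => (M.det.eval t)⁻¹ * (M.adjugate i j).eval t := by
    funext t
    rw [Matrix.inv_def, hd, Ring.inverse_eq_inv', ← hM, ← RingHom.map_adjugate]
    rfl
  rw [this]
  rw [hd] at hs
  exact (M.det.differentiable.differentiableAt.inv hs).mul
    (M.adjugate i j).differentiable.differentiableAt

theorem differentiableAt_matrix_mul {k l m : ℕ} {A : ℂ → Matrix (Fin k) (Fin l) ℂ}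
    {B : ℂ → Matrix (Fin l) (Fin m) ℂ} {s : ℂ}
    (hA : ∀ i j, DifferentiableAt ℂ (fun t => A t i j) s)
    (hB : ∀ i j, DifferentiableAt ℂ (fun t => B t i j) s) (i : Fin k) (j : Fin m) :
    DifferentiableAt ℂ (fun t => (A t * B t) i j) s := by
  simp only [Matrix.mul_apply]
  exact DifferentiableAt.fun_sum fun a _ => (hA i a).mul (hB a j)

theorem differentiableAt_extendOne {m n : ℕ} (h : m ≤ n) {A : ℂ → Matrix (Fin m) (Fin m) ℂ} {s : ℂ}
    (hA : ∀ i j, DifferentiableAt ℂ (fun t => A t i j) s) (i j : Fin n) :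
    DifferentiableAt ℂ (fun t => extendOne h (A t) i j) s := by
  have h1 : ∀ i j, DifferentiableAt ℂ (fun t => (A t - 1) i j) s :=
    fun i j => (hA i j).sub (differentiableAt_const _)
  have h2 := differentiableAt_matrix_mul (A := fun _ => incl h)
    (fun _ _ => differentiableAt_const _) h1
  have h3 := differentiableAt_matrix_mul (B := fun _ => (incl h)ᵀ) h2
    fun _ _ => differentiableAt_const _
  exact (h3 i j).const_add ((1 : Matrix (Fin n) (Fin n) ℂ) i j)

/-- The velocity of the conjugates of `x` by the extensions of `1 + t • u`. -/
theorem hasDerivAt_conj_line {m n : ℕ} (h : m ≤ n) (x : Matrix (Fin n) (Fin n) ℂ)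
    (u : Matrix (Fin m) (Fin m) ℂ) {s : ℂ} (hs : (1 + s • u).det ≠ 0)
    {y U : Matrix (Fin n) (Fin n) ℂ}
    (hy : y = extendOne h (1 + s • u) * x * extendOne h (1 + s • u)⁻¹)
    (hU : U = incl h * (u * (1 + s • u)⁻¹) * (incl h)ᵀ) (i j : Fin n) :
    HasDerivAt (fun t : ℂ => (extendOne h (1 + t • u) * x * extendOne h (1 + t • u)⁻¹) i j)
      (((-1 : ℂ) • (y * U - U * y)) i j) s := by
  set γ : ℂ → Matrix (Fin n) (Fin n) ℂ :=
    fun t => extendOne h (1 + t • u) * x * extendOne h (1 + t • u)⁻¹ with hγ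
  have hinv : ∀ t : ℂ, (1 + t • u).det ≠ 0 →
      extendOne h (1 + t • u)⁻¹ * extendOne h (1 + t • u) = 1 := by
    intro t ht
    rw [extendOne_mul, Matrix.nonsing_inv_mul _ (isUnit_iff_ne_zero.2 ht), extendOne_one]
  set V : Matrix (Fin n) (Fin n) ℂ := incl h * u * (incl h)ᵀ with hV
  have hG : ∀ t : ℂ, extendOne h (1 + t • u) = 1 + t • V := by
    intro t
    simp [extendOne, hV]
  have hd1 : ∀ i j, DifferentiableAt ℂ (fun t : ℂ => (1 + t • u) i j) s :=
    fun i j => (hasDerivAt_line 1 u i j s).differentiableAt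
  have hd2 := differentiableAt_extendOne h hd1
  have hd3 := differentiableAt_extendOne h (differentiableAt_inv_line u hs)
  have hd4 := differentiableAt_matrix_mul (B := fun _ => x) hd2 fun _ _ => differentiableAt_const _
  have hdiff : ∀ i j, DifferentiableAt ℂ (fun t => γ t i j) s := differentiableAt_matrix_mul hd4 hd3
  -- The velocity `D` is found by differentiating `γ t * G t = G t * x`.
  set D : Matrix (Fin n) (Fin n) ℂ := Matrix.of fun i j => deriv (fun t => γ t i j) s
  have hD : ∀ i j, HasDerivAt (fun t => γ t i j) (D i j) s := fun i j => (hdiff i j).hasDerivAt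
  have hγG : ∀ t : ℂ, (1 + t • u).det ≠ 0 → γ t * (1 + t • V) = (1 + t • V) * x := by
    intro t ht
    simp only [hγ]
    rw [← hG, mul_assoc, hinv t ht, mul_one]
  have hDG : D * (1 + s • V) + γ s * V = V * x := by
    ext i j
    have e1 : HasDerivAt (fun t => (γ t * (1 + t • V)) i j)
        ((D * (1 + s • V) + γ s * V) i j) s := by
      simp only [Matrix.mul_apply, Matrix.add_apply _ (γ s * V), ← Finset.sum_add_distrib]
      exact HasDerivAt.fun_sum fun k _ => (hD i k).mul (hasDerivAt_line 1 V k j s)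
    have e2 : HasDerivAt (fun t : ℂ => ((1 + t • V) * x) i j) ((V * x) i j) s := by
      simp only [Matrix.mul_apply]
      exact HasDerivAt.fun_sum fun k _ => (hasDerivAt_line 1 V i k s).mul_const _
    refine e1.unique (e2.congr_of_eventuallyEq ?_)
    filter_upwards [(isOpen_isPreconnected_line u).1.mem_nhds hs] with t ht
    rw [hγG t ht]
  have hVU : V * extendOne h (1 + s • u)⁻¹ = U := by
    rw [hV, hU, Matrix.mul_assoc, inclT_mul_extendOne]
    simp only [Matrix.mul_assoc]
  have hDU : D = (-1 : ℂ) • (y * U - U * y) := by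
    have e3 := mul_eq_one_comm.1 (hinv s hs)
    have e4 : x * extendOne h (1 + s • u)⁻¹ = extendOne h (1 + s • u)⁻¹ * y := by
      rw [hy, ← mul_assoc, ← mul_assoc, hinv s hs, one_mul]
    calc D = (D * (1 + s • V)) * extendOne h (1 + s • u)⁻¹ := by
          rw [← hG, mul_assoc, e3, mul_one]
      _ = (V * x - y * V) * extendOne h (1 + s • u)⁻¹ := by
          rw [eq_sub_of_add_eq hDG, hy]
      _ = U * y - y * U := by
          rw [sub_mul, mul_assoc, e4, ← mul_assoc, mul_assoc y, hVU]
      _ = _ := by rw [neg_one_smul, neg_sub]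
  exact hDU ▸ hD i j

/-- A function that Poisson commutes with `J n` is constant along the Hamiltonian flows of `J n`:
it is invariant under conjugation by the invertible polynomials in a block `x_m`. The element `w`
is joined to `1` by the line `1 + t • (w - 1)`, whose invertible points form a connected set. -/
theorem value_conj_eq {m n : ℕ} (hm : 1 ≤ m) (h : m ≤ n) {f : P n}
    (hf : ∀ q ∈ J n, poisson f q = 0) (x : Matrix (Fin n) (Fin n) ℂ) (p : Polynomial ℂ)
    {w v : Matrix (Fin m) (Fin m) ℂ} (hw : w = Polynomial.aeval (block h x) p) (hwv : w * v = 1) :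
    value f (extendOne h w * x * extendOne h v) = value f x := by
  have hl : ∀ s : ℂ, 1 + s • (w - 1) =
      Polynomial.aeval (block h x) (1 + Polynomial.C s * (p - 1)) := by
    intro s
    simp [hw, Algebra.smul_def]
  have hderiv : ∀ s : ℂ, (1 + s • (w - 1)).det ≠ 0 → HasDerivAt (fun t : ℂ => value f
      (extendOne h (1 + t • (w - 1)) * x * extendOne h (1 + t • (w - 1))⁻¹)) 0 s := by
    intro s hs
    have hcomm : Commute (1 + s • (w - 1)) (block h x) := by
      rw [hl]
      simpa using (Commute.all (1 + Polynomial.C s * (p - 1)) Polynomial.X).map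
        (Polynomial.aeval (R := ℂ) (block h x))
    obtain ⟨q, hq⟩ := exists_aeval_mul_eq_one (1 + s • (w - 1)) hs
    have hq' : (1 + s • (w - 1))⁻¹ =
        Polynomial.aeval (block h x) (q.comp (1 + Polynomial.C s * (p - 1))) := by
      rw [Polynomial.aeval_comp, ← hl]
      exact Matrix.inv_eq_right_inv hq
    have hblock := block_conj h x (Matrix.nonsing_inv_mul _ (isUnit_iff_ne_zero.2 hs)) hcomm
    have hz := dirDeriv_commutator_eq_zero hm h hf
      (extendOne h (1 + s • (w - 1)) * x * extendOne h (1 + s • (w - 1))⁻¹)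
      ((p - 1) * q.comp (1 + Polynomial.C s * (p - 1)))
    rw [hblock, map_mul, ← hq', map_sub, ← hw, map_one] at hz
    have := hasDerivAt_value f (hasDerivAt_conj_line h x (w - 1) hs rfl rfl)
    rwa [dirDeriv_smul_right, hz, mul_zero] at this
  have h1 : (1 + (1 : ℂ) • (w - 1)).det ≠ 0 := by
    have := congrArg Matrix.det hwv
    rw [Matrix.det_mul, Matrix.det_one] at this
    simpa using left_ne_zero_of_mul_eq_one this
  obtain ⟨hopen, hconn⟩ := isOpen_isPreconnected_line (w - 1)
  have := hopen.is_const_of_deriv_eq_zero hconn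
    (fun s hs => (hderiv s hs).differentiableAt.differentiableWithinAt)
    (fun s hs => (hderiv s hs).deriv) h1 (show (0 : ℂ) ∈ _ by simp)
  have hv : w⁻¹ = v := Matrix.inv_eq_right_inv hwv
  simpa [extendOne_one, hv] using this

/-! ### Reduction of generic matrices to Hessenberg form -/

/-- The part of row `k` that lies to the left of the diagonal. -/
def rowPart {R : Type*} {n : ℕ} (k : Fin n) (x : Matrix (Fin n) (Fin n) R) : Fin k → R :=
  fun j => x k (Fin.castLE k.2.le j)

/-- The matrix with rows `c, c * y, c * y ^ 2, …`. The row vector `c` is cyclic for `y` exactly if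
this matrix is invertible. -/
def krylov {R : Type*} [CommRing R] {m : ℕ} (c : Fin m → R) (y : Matrix (Fin m) (Fin m) R) :
    Matrix (Fin m) (Fin m) R :=
  Matrix.of fun l => c ᵥ* y ^ (l : ℕ)

/-- The row vector `(0, …, 0, 1)`. -/
def lastRow (m : ℕ) : Fin m → ℂ := fun j => if (j : ℕ) + 1 = m then 1 else 0

theorem krylov_mul {m : ℕ} (c : Fin m → ℂ) {y w : Matrix (Fin m) (Fin m) ℂ} (h : Commute w y) :
    krylov c y * w = krylov (c ᵥ* w) y := by
  ext l j
  have : (c ᵥ* y ^ (l : ℕ)) ᵥ* w = (c ᵥ* w) ᵥ* y ^ (l : ℕ) := by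
    rw [Matrix.vecMul_vecMul, Matrix.vecMul_vecMul, (h.pow_right _).eq]
  exact congrFun this j

/-- `x` agrees below the diagonal, in the first `m` columns and rows, with the shift matrix, which
has ones on the first subdiagonal and zeros below it. -/
def IsHessenberg {n : ℕ} (m : ℕ) (x : Matrix (Fin n) (Fin n) ℂ) : Prop :=
  ∀ i j : Fin n, (i : ℕ) < m → j < i → x i j = if (i : ℕ) = j + 1 then 1 else 0

theorem IsHessenberg.block {m n : ℕ} (h : m ≤ n) {x : Matrix (Fin n) (Fin n) ℂ}
    (hx : IsHessenberg m x) : IsHessenberg m (block h x) :=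
  fun i j _ hij => hx (Fin.castLE h i) (Fin.castLE h j) i.2 hij

/-- For a Hessenberg matrix `y`, the last unit vector is cyclic: up to the order of its rows, the
Krylov matrix is unitriangular. -/
theorem det_krylov_lastRow_ne_zero {m : ℕ} {y : Matrix (Fin m) (Fin m) ℂ} (hy : IsHessenberg m y) :
    (krylov (lastRow m) y).det ≠ 0 := by
  have key : ∀ (l : ℕ) (j : Fin m), (j : ℕ) + l + 1 ≤ m →
      (lastRow m ᵥ* y ^ l) j = if (j : ℕ) + l + 1 = m then 1 else 0 := by
    intro l
    induction l with
    | zero => intro j _; simp [lastRow]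
    | succ l ih =>
      intro j hj
      have hj' : (j : ℕ) + 1 < m := by omega
      rw [pow_succ, ← Matrix.vecMul_vecMul]
      simp only [Matrix.vecMul, dotProduct]
      rw [Finset.sum_eq_single (⟨j + 1, hj'⟩ : Fin m)]
      · have h1 := ih ⟨j + 1, hj'⟩ (by simp only; omega)
        have h2 : y ⟨j + 1, hj'⟩ j = 1 := by
          rw [hy _ _ hj' (by simp [Fin.lt_def])]
          simp
        simp only [Matrix.vecMul, dotProduct] at h1
        rw [h1, h2, mul_one]
        simp only [show (j : ℕ) + 1 + l + 1 = j + (l + 1) + 1 by omega]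
      · intro i _ hi
        have hi' : (i : ℕ) ≠ j + 1 := fun h => hi (Fin.ext h)
        rcases le_or_gt (i : ℕ) j with hij | hij
        · have h1 := ih i (by omega)
          simp only [Matrix.vecMul, dotProduct] at h1
          rw [h1, if_neg (by omega), zero_mul]
        · rw [hy i j i.2 hij, if_neg hi', mul_zero]
      · simp
  have hdet : ((krylov (lastRow m) y).submatrix Fin.revPerm id).det = 1 := by
    rw [Matrix.det_of_isUpperTriangular]
    · refine Finset.prod_eq_one fun i _ => ?_
      have hi := i.2
      change (lastRow m ᵥ* y ^ (Fin.rev i : ℕ)) i = 1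
      rw [key _ _ (by rw [Fin.val_rev]; omega)]
      exact if_pos (by rw [Fin.val_rev]; omega)
    · intro i j hij
      have hij' : (j : ℕ) < i := hij
      have hi := i.2
      change (lastRow m ᵥ* y ^ (Fin.rev i : ℕ)) j = 0
      rw [key _ _ (by rw [Fin.val_rev]; omega)]
      exact if_neg (by rw [Fin.val_rev]; omega)
  intro h0
  rw [Matrix.det_permute, h0, mul_zero] at hdet
  exact zero_ne_one hdet

/-- A cyclic row vector `c` of a Hessenberg matrix `y` is carried to the last unit vector by an
invertible polynomial in `y`. -/
theorem exists_aeval_vecMul_eq_lastRow {m : ℕ} {y : Matrix (Fin m) (Fin m) ℂ}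
    (hy : IsHessenberg m y) {c : Fin m → ℂ} (hc : (krylov c y).det ≠ 0) :
    ∃ p : Polynomial ℂ, c ᵥ* Polynomial.aeval y p = lastRow m ∧ (Polynomial.aeval y p).det ≠ 0 := by
  set a := lastRow m ᵥ* (krylov c y)⁻¹ with ha
  set p : Polynomial ℂ := ∑ l : Fin m, Polynomial.monomial l (a l) with hp
  have hcp : c ᵥ* Polynomial.aeval y p = lastRow m := by
    have h1 : a ᵥ* krylov c y = lastRow m := by
      rw [ha, Matrix.vecMul_vecMul, Matrix.nonsing_inv_mul _ (isUnit_iff_ne_zero.2 hc),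
        Matrix.vecMul_one]
    rw [← h1, hp, map_sum, Matrix.vecMul_sum]
    ext j
    simp only [Polynomial.aeval_monomial, ← Algebra.smul_def, Matrix.vecMul_smul, Finset.sum_apply,
      Pi.smul_apply, smul_eq_mul]
    rfl
  refine ⟨p, hcp, fun h0 => det_krylov_lastRow_ne_zero hy ?_⟩
  have hcomm : Commute (Polynomial.aeval y p) y := by
    simpa using (Commute.all p Polynomial.X).map (Polynomial.aeval (R := ℂ) y)
  rw [← hcp, ← krylov_mul c hcomm, Matrix.det_mul, h0, mul_zero]

/-- The determinant that detects whether row `k` of `x` is cyclic for the block `x_k`. -/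
def cyclicDet {R : Type*} [CommRing R] {n : ℕ} (k : Fin n) (x : Matrix (Fin n) (Fin n) R) : R :=
  (krylov (rowPart k x) (block k.2.le x)).det

theorem map_cyclicDet {R S : Type*} [CommRing R] [CommRing S] (φ : R →+* S) {n : ℕ} (k : Fin n)
    (x : Matrix (Fin n) (Fin n) R) : cyclicDet k (φ.mapMatrix x) = φ (cyclicDet k x) := by
  rw [cyclicDet, cyclicDet, RingHom.map_det]
  congr 1
  ext l j
  have h1 : block k.2.le (φ.mapMatrix x) ^ (l : ℕ) = φ.mapMatrix (block k.2.le x ^ (l : ℕ)) := by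
    rw [map_pow]
    rfl
  change (rowPart k (φ.mapMatrix x) ᵥ* block k.2.le (φ.mapMatrix x) ^ (l : ℕ)) j =
    φ ((rowPart k x ᵥ* block k.2.le x ^ (l : ℕ)) j)
  rw [h1, RingHom.map_vecMul]
  rfl

theorem rowPart_eq {n : ℕ} (k : Fin n) (x : Matrix (Fin n) (Fin n) ℂ) :
    rowPart k x = x k ᵥ* incl k.2.le := by
  ext j
  simp [rowPart, incl, Matrix.vecMul, dotProduct, Matrix.one_apply]

theorem extendOne_extendOne {l m n : ℕ} (h : l ≤ m) (h' : m ≤ n) (u : Matrix (Fin l) (Fin l) ℂ) :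
    extendOne h' (extendOne h u) = extendOne (h.trans h') u := by
  have hincl : incl (h.trans h') = incl h' * incl h := by
    rw [mul_incl]
    ext i j
    simp [incl, Matrix.one_apply, Fin.castLE_castLE]
  simp only [extendOne, hincl, add_sub_cancel_left, Matrix.transpose_mul, Matrix.mul_assoc]

theorem rowPart_conj {n : ℕ} (k : Fin n) (v w : Matrix (Fin k) (Fin k) ℂ)
    (x : Matrix (Fin n) (Fin n) ℂ) :
    rowPart k (extendOne k.2.le v * x * extendOne k.2.le w) = rowPart k x ᵥ* w := by
  have h1 : (extendOne k.2.le v) k = (1 : Matrix (Fin n) (Fin n) ℂ) k := by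
    ext j
    have : ∀ i : Fin k, incl k.2.le k i = 0 := by
      intro i
      have : k ≠ Fin.castLE k.2.le i := fun h => i.2.ne' (congrArg Fin.val h)
      simp [incl, this]
    simp [extendOne, Matrix.mul_apply, this]
  rw [rowPart_eq, rowPart_eq, Matrix.mul_assoc, Matrix.mul_apply_eq_vecMul, h1,
    ← Matrix.mul_apply_eq_vecMul, Matrix.one_mul, Matrix.mul_apply_eq_vecMul,
    Matrix.vecMul_vecMul, extendOne_mul_incl, Matrix.vecMul_vecMul]

/-- Conjugation by a matrix that differs from `1` only in the first `m` rows and columns does not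
affect the cyclicity of the rows with index at least `m`. -/
theorem cyclicDet_conj_ne_zero {m n : ℕ} (h : m ≤ n) (k : Fin n) (hk : m ≤ k)
    {v w : Matrix (Fin m) (Fin m) ℂ} (hvw : v * w = 1) {x : Matrix (Fin n) (Fin n) ℂ}
    (hx : cyclicDet k x ≠ 0) : cyclicDet k (extendOne h v * x * extendOne h w) ≠ 0 := by
  rw [← extendOne_extendOne hk k.2.le v, ← extendOne_extendOne hk k.2.le w]
  set vk := extendOne hk v with hvk
  set wk := extendOne hk w with hwk
  have hwv' : wk * vk = 1 := by
    rw [hvk, hwk, extendOne_mul, mul_eq_one_comm.1 hvw, extendOne_one]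
  have hblock : block k.2.le (extendOne k.2.le vk * x * extendOne k.2.le wk) =
      vk * block k.2.le x * wk := by
    rw [← inclT_mul_mul_incl, ← inclT_mul_mul_incl, Matrix.mul_assoc, Matrix.mul_assoc,
      extendOne_mul_incl, ← Matrix.mul_assoc, ← Matrix.mul_assoc, ← Matrix.mul_assoc,
      inclT_mul_extendOne]
    simp only [Matrix.mul_assoc]
  have hpow : ∀ l : ℕ, wk * (vk * block k.2.le x * wk) ^ l = block k.2.le x ^ l * wk := by
    intro l
    induction l with
    | zero => simp
    | succ l ih =>
      rw [pow_succ, ← mul_assoc, ih, mul_assoc, ← mul_assoc wk, ← mul_assoc wk, hwv', one_mul,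
        ← mul_assoc, ← pow_succ]
  have hkry : krylov (rowPart k x ᵥ* wk) (vk * block k.2.le x * wk) =
      krylov (rowPart k x) (block k.2.le x) * wk := by
    ext l j
    have : (rowPart k x ᵥ* wk) ᵥ* (vk * block k.2.le x * wk) ^ (l : ℕ) =
        (rowPart k x ᵥ* block k.2.le x ^ (l : ℕ)) ᵥ* wk := by
      rw [Matrix.vecMul_vecMul, hpow, Matrix.vecMul_vecMul]
    exact congrFun this j
  rw [cyclicDet, rowPart_conj, hblock, hkry, Matrix.det_mul]
  refine mul_ne_zero hx fun h0 => ?_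
  have := congrArg Matrix.det hwv'
  simp [h0] at this

/-- A function that Poisson commutes with `J n` and vanishes on Hessenberg matrices vanishes at all
matrices whose rows are cyclic for the blocks above them: the flows of `J n` bring one row after
the other into Hessenberg form. -/
theorem value_eq_zero_of_cyclic {n : ℕ} {f : P n} (hf : ∀ q ∈ J n, poisson f q = 0)
    (h0 : ∀ x, IsHessenberg n x → value f x = 0) {m : ℕ} (h : m ≤ n) :
    ∀ x : Matrix (Fin n) (Fin n) ℂ, IsHessenberg m x →
      (∀ k : Fin n, m ≤ k → cyclicDet k x ≠ 0) → value f x = 0 := by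
  induction h using Nat.decreasingInduction with
  | self => exact fun x hx _ => h0 x hx
  | of_succ m h ih =>
    intro x hx hc
    rcases Nat.eq_zero_or_pos m with rfl | hm
    · refine ih x (fun i j hi hij => ?_) fun k hk => hc k (by omega)
      have := Fin.lt_def.1 hij
      omega
    have hmn : m ≤ n := Nat.le_of_lt h
    obtain ⟨p, hp, hdet⟩ := exists_aeval_vecMul_eq_lastRow (hx.block hmn) (hc ⟨m, h⟩ le_rfl)
    set w := Polynomial.aeval (block hmn x) p with hw
    have hwv : w * w⁻¹ = 1 := Matrix.mul_nonsing_inv _ (isUnit_iff_ne_zero.2 hdet)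
    have hvw : w⁻¹ * w = 1 := Matrix.nonsing_inv_mul _ (isUnit_iff_ne_zero.2 hdet)
    set v := w⁻¹ with hv
    have hcomm : v * block hmn x = block hmn x * v := by
      have : w * block hmn x = block hmn x * w := by
        simpa using ((Commute.all p Polynomial.X).map
          (Polynomial.aeval (R := ℂ) (block hmn x))).eq
      calc v * block hmn x = v * (block hmn x * w) * v := by
            rw [mul_assoc, mul_assoc, hwv, mul_one]
        _ = block hmn x * v := by rw [← this, ← mul_assoc, hvw, one_mul]
    set x' := extendOne hmn v * x * extendOne hmn w with hx'
    have hb : block hmn x' = block hmn x := block_conj hmn x hwv hcomm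
    have hrow : rowPart ⟨m, h⟩ x' = lastRow m := by
      rw [← hp]
      exact rowPart_conj ⟨m, h⟩ v w x
    have hxx' : extendOne hmn w * x' * extendOne hmn v = x := by
      rw [hx', ← mul_assoc, ← mul_assoc, extendOne_mul, mul_assoc, extendOne_mul, hwv,
        extendOne_one, one_mul, mul_one]
    have hval : value f x' = 0 := by
      refine ih x' (fun i j hi hij => ?_) fun k hk =>
        cyclicDet_conj_ne_zero hmn k (by omega) hvw (hc k (by omega))
      have hij' := Fin.lt_def.1 hij
      rcases Nat.lt_succ_iff_lt_or_eq.1 hi with hi | hi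
      · rw [← hx i j hi hij]
        exact congrFun (congrFun hb ⟨i, hi⟩) ⟨j, by omega⟩
      · have := congrFun hrow ⟨j, show (j : ℕ) < m by omega⟩
        have hi' : i = ⟨m, h⟩ := Fin.ext hi
        subst hi'
        simp only [rowPart, lastRow] at this
        simpa [eq_comm] using this
    rw [← hxx', value_conj_eq hm hmn hf x' p (hb ▸ hw) hwv, hval]

/-- A function that Poisson commutes with `J n` is determined by its restriction to the Hessenberg
matrices. -/
theorem eq_zero_of_value_hessenberg {n : ℕ} {f : P n} (hf : ∀ q ∈ J n, poisson f q = 0)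
    (h0 : ∀ x, IsHessenberg n x → value f x = 0) : f = 0 := by
  set X := Matrix.mvPolynomialX (Fin n) (Fin n) ℂ
  have hval : ∀ (k : Fin n) x, value (cyclicDet k X) x = cyclicDet k x := by
    intro k x
    conv_rhs => rw [← map_mvPolynomialX x, map_cyclicDet]
    rfl
  have hprod : f * ∏ k : Fin n, cyclicDet k X = 0 := by
    refine eq_of_value fun x => ?_
    have h1 : value (f * ∏ k : Fin n, cyclicDet k X) x = value f x * ∏ k, cyclicDet k x := by
      simp only [← hval]
      simp only [value, map_mul, map_prod]
    rw [h1, show value (0 : P n) x = 0 from map_zero _]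
    by_cases hx : ∀ k : Fin n, cyclicDet k x ≠ 0
    · rw [value_eq_zero_of_cyclic hf h0 (Nat.zero_le n) x (fun i j hi => absurd hi (by omega))
        fun k _ => hx k, zero_mul]
    · push Not at hx
      obtain ⟨k, hk⟩ := hx
      rw [Finset.prod_eq_zero (Finset.mem_univ k) hk, mul_zero]
  refine (mul_eq_zero.1 hprod).resolve_right (Finset.prod_ne_zero_iff.2 fun k _ hk => ?_)
  -- The shift matrix has cyclic rows.
  set b : Matrix (Fin n) (Fin n) ℂ := Matrix.of fun i j => if (i : ℕ) = j + 1 then 1 else 0 with hb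
  have hbk := hval k b
  rw [hk] at hbk
  have hrow : rowPart k b = lastRow k := by
    ext j
    simp [rowPart, lastRow, hb, eq_comm]
  refine det_krylov_lastRow_ne_zero
    (IsHessenberg.block (m := k) k.2.le (x := b) fun i j _ _ => rfl) ?_
  rw [← hrow]
  exact hbk.symm.trans (map_zero _)

/-! ### Characteristic polynomials of the blocks of a Hessenberg matrix -/

/-- The recursion for the characteristic polynomials of the leading blocks of a matrix with ones on
the subdiagonal and zeros below it. The row of the smaller characteristic polynomials is mapped by
the characteristic matrix to a multiple of the last unit row; multiply by the adjugate. -/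
theorem charpoly_block_succ {R : Type*} [CommRing R] {n : ℕ} {x : Matrix (Fin n) (Fin n) R}
    (hx : ∀ i j : Fin n, j < i → x i j = if (i : ℕ) = j + 1 then 1 else 0) (m : ℕ) :
    ∀ h : m < n, (block (Nat.succ_le_of_lt h) x).charpoly =
      Polynomial.X * (block h.le x).charpoly - ∑ i : Fin (m + 1),
        Polynomial.C (x (Fin.castLE (Nat.succ_le_of_lt h) i) ⟨m, h⟩) *
          (block ((Nat.le_of_lt_succ i.2).trans h.le) x).charpoly := by
  induction m using Nat.strong_induction_on with
  | _ m ih =>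
    intro h
    have hle : m + 1 ≤ n := h
    set N := (block hle x).charmatrix with hN
    set r : Fin (m + 1) → Polynomial R :=
      fun i => (block ((Nat.le_of_lt_succ i.2).trans h.le) x).charpoly with hr
    set Q : Polynomial R := Polynomial.X * (block h.le x).charpoly - ∑ i : Fin (m + 1),
        Polynomial.C (x (Fin.castLE hle i) ⟨m, h⟩) * r i with hQ
    have hNX : ∀ j, (r ᵥ* N) j = Polynomial.X * r j -
        ∑ i, Polynomial.C (block hle x i j) * r i := by
      intro j
      simp only [Matrix.vecMul, dotProduct, hN, Matrix.charmatrix_apply, mul_sub,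
        Finset.sum_sub_distrib, Matrix.diagonal_apply, mul_ite, mul_zero, Finset.sum_ite_eq',
        Finset.mem_univ, if_true]
      rw [mul_comm]
      exact congrArg _ (Finset.sum_congr rfl fun i _ => mul_comm _ _)
    have hrow : r ᵥ* N = Pi.single (Fin.last m) Q := by
      ext1 j
      rw [hNX]
      rcases Fin.eq_castSucc_or_eq_last j with ⟨j, rfl⟩ | rfl
      · have hj := j.2
        have hjn : (j : ℕ) < n := by omega
        rw [Pi.single_eq_of_ne (Fin.castSucc_lt_last j).ne, sub_eq_zero]
        set F : ℕ → Polynomial R := fun i => if hi : i < m + 1 then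
          Polynomial.C (block hle x ⟨i, hi⟩ j.castSucc) * r ⟨i, hi⟩ else 0 with hF
        have hsum : ∀ l, ∀ hl : l ≤ m + 1, ∑ i : Fin l, Polynomial.C
            (block hle x (Fin.castLE hl i) j.castSucc) * r (Fin.castLE hl i) =
            ∑ i ∈ Finset.range l, F i := by
          intro l hl
          rw [← Fin.sum_univ_eq_sum_range]
          refine Finset.sum_congr rfl fun i _ => ?_
          simp only [hF]
          rw [dif_pos (i.2.trans_le hl)]
          rfl
        have hjrec := ih j hj hjn
        have hFj : F (j + 1) = (block (Nat.succ_le_of_lt hjn) x).charpoly := by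
          have : block hle x ⟨j + 1, by omega⟩ j.castSucc = 1 := by
            have := hx ⟨j + 1, by omega⟩ ⟨j, hjn⟩ (by simp [Fin.lt_def])
            rw [if_pos rfl] at this
            exact this
          simp only [hF]
          rw [dif_pos (by omega), this, map_one, one_mul]
        -- The entries more than one step below the diagonal vanish.
        have hzero : ∑ i ∈ Finset.range (m + 1), F i = ∑ i ∈ Finset.range (j + 2), F i := by
          refine (Finset.sum_subset (Finset.range_mono (by omega)) fun i hi hij => ?_).symm
          rw [Finset.mem_range] at hi hij
          have : block hle x ⟨i, hi⟩ j.castSucc = 0 := by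
            have := hx ⟨i, by omega⟩ ⟨j, hjn⟩ (by simp only [Fin.lt_def]; omega)
            rw [if_neg (by simp only; omega)] at this
            exact this
          simp only [hF]
          rw [dif_pos hi, this, map_zero, zero_mul]
        have e1 := hsum (m + 1) le_rfl
        have e2 := hsum (j + 1) (by omega)
        have e3 : ∑ i : Fin (j + 1), Polynomial.C
            (x (Fin.castLE (Nat.succ_le_of_lt hjn) i) ⟨j, hjn⟩) *
            (block ((Nat.le_of_lt_succ i.2).trans hjn.le) x).charpoly =
            ∑ i ∈ Finset.range (j + 1), F i := e2
        rw [e3, ← hFj, eq_sub_iff_add_eq, add_comm, ← Finset.sum_range_succ, ← hzero, ← e1] at hjrec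
        exact hjrec.symm
      · rw [Pi.single_eq_same]
        rfl
    have hadj : N.adjugate (Fin.last m) 0 = 1 := by
      have hent : ∀ i j : Fin m, j ≤ i → (N.submatrix (Fin.succAbove 0) (Fin.last m).succAbove) i j
          = if i = j then -1 else 0 := by
        intro i j hij
        have hij' := Fin.le_def.1 hij
        have hne : i.succ ≠ j.castSucc := by
          intro h
          have := congrArg Fin.val h
          simp only [Fin.val_succ, Fin.val_castSucc] at this
          omega
        have hxe := hx (Fin.castLE hle i.succ) (Fin.castLE hle j.castSucc)
          (by simp only [Fin.lt_def, Fin.val_castLE, Fin.val_succ, Fin.val_castSucc]; omega)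
        rw [Matrix.submatrix_apply, Fin.succAbove_zero, Fin.succAbove_last, hN,
          Matrix.charmatrix_apply_ne _ _ _ hne, block, Matrix.submatrix_apply, hxe]
        by_cases h : i = j
        · rw [if_pos (by simp [h]), if_pos h, map_one]
        · rw [if_neg (by simpa [Fin.ext_iff] using h), if_neg h, map_zero, neg_zero]
      rw [Matrix.adjugate_fin_succ_eq_det_submatrix, Matrix.det_of_isUpperTriangular,
        Finset.prod_congr rfl fun i _ => (hent i i le_rfl).trans (if_pos rfl)]
      · simp [← mul_pow]
      · intro i j hij
        rw [hent i j (le_of_lt hij), if_neg (Ne.symm (ne_of_lt (show j < i from hij)))]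
    have h1 : (r ᵥ* N) ᵥ* N.adjugate = N.det • r := by
      rw [Matrix.vecMul_vecMul, Matrix.mul_adjugate, Matrix.vecMul_smul, Matrix.vecMul_one]
    have h2 := congrFun h1 0
    have hr0 : r 0 = 1 := Matrix.det_fin_zero
    rw [hrow, Matrix.single_vecMul, Pi.smul_apply, Pi.smul_apply, Matrix.row_apply, hadj, hr0,
      smul_eq_mul, smul_eq_mul, mul_one, mul_one] at h2
    exact h2.symm

/-- The entries of a Hessenberg matrix on and above the diagonal are polynomials in the coefficients
of the characteristic polynomials of its leading blocks. -/
theorem mem_of_charpoly_coeff_mem {R : Type*} [CommRing R] [Algebra ℂ R] [Nontrivial R] {n : ℕ}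
    {x : Matrix (Fin n) (Fin n) R}
    (hx : ∀ i j : Fin n, j < i → x i j = if (i : ℕ) = j + 1 then 1 else 0) (S : Subalgebra ℂ R)
    (hS : ∀ (m : ℕ) (h : m ≤ n) (k : ℕ), (block h x).charpoly.coeff k ∈ S) (i j : Fin n)
    (hij : i ≤ j) : x i j ∈ S := by
  obtain ⟨m, h⟩ := j
  have key : ∀ d : ℕ, ∀ i : Fin (m + 1), (i : ℕ) + d = m →
      x (Fin.castLE (Nat.succ_le_of_lt h) i) ⟨m, h⟩ ∈ S := by
    -- Coefficient `i` of the recursion for column `m` isolates `x i m`, because the characteristic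
    -- polynomial of the block of size `i` is monic and the smaller ones have no such coefficient.
    intro d
    induction d using Nat.strong_induction_on with
    | _ d ih =>
      intro i hi
      have hrec := congrArg (fun q => Polynomial.coeff q i) (charpoly_block_succ hx m h)
      simp only [Polynomial.coeff_sub, Polynomial.finsetSum_coeff, Polynomial.coeff_C_mul] at hrec
      rw [← Finset.add_sum_erase _ _ (Finset.mem_univ i)] at hrec
      have hone : (block ((Nat.le_of_lt_succ i.2).trans h.le) x).charpoly.coeff i = 1 := by
        have := (Matrix.charpoly_monic (block ((Nat.le_of_lt_succ i.2).trans h.le) x))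
        have hd := Matrix.charpoly_natDegree_eq_dim (block ((Nat.le_of_lt_succ i.2).trans h.le) x)
        rw [Fintype.card_fin] at hd
        rw [Polynomial.Monic, Polynomial.leadingCoeff, hd] at this
        exact this
      rw [hone, mul_one] at hrec
      rw [show x (Fin.castLE (Nat.succ_le_of_lt h) i) ⟨m, h⟩ =
        (Polynomial.X * (block h.le x).charpoly).coeff i -
          (block (Nat.succ_le_of_lt h) x).charpoly.coeff i -
          ∑ l ∈ Finset.univ.erase i, x (Fin.castLE (Nat.succ_le_of_lt h) l) ⟨m, h⟩ *
            (block ((Nat.le_of_lt_succ l.2).trans h.le) x).charpoly.coeff i by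
          rw [hrec]; ring]
      refine S.sub_mem (S.sub_mem ?_ (hS _ _ _)) (S.sum_mem fun l hl => ?_)
      · rcases Nat.eq_zero_or_pos (i : ℕ) with h0 | h0
        · rw [h0, Polynomial.coeff_X_mul_zero]
          exact S.zero_mem
        · obtain ⟨k, hk⟩ := Nat.exists_eq_succ_of_ne_zero h0.ne'
          rw [hk, Polynomial.coeff_X_mul]
          exact hS _ _ _
      · have hl' : (l : ℕ) ≠ i := fun h => (Finset.mem_erase.1 hl).1 (Fin.ext h)
        rcases lt_or_gt_of_ne hl' with hli | hli
        · rw [Polynomial.coeff_eq_zero_of_natDegree_lt, mul_zero]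
          · exact S.zero_mem
          · rw [Matrix.charpoly_natDegree_eq_dim, Fintype.card_fin]
            exact hli
        · exact S.mul_mem (ih (m - l) (by omega) l (by omega)) (hS _ _ _)
  have hij' : (i : ℕ) ≤ m := hij
  exact key (m - i) ⟨i, by omega⟩ (by simp only; omega)

/-! ### The section of Hessenberg matrices -/

/-- The positions on and above the diagonal, with the column first. They also index the
coefficients of the characteristic polynomials of the blocks: `⟨m, k⟩` stands for the `k`-th
coefficient for the block of size `m + 1`. -/
abbrev UpperIndex (n : ℕ) : Type := Σ m : Fin n, Fin (m + 1)

theorem card_upperIndex (n : ℕ) : Fintype.card (UpperIndex n) = n * (n + 1) / 2 := by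
  rw [Fintype.card_sigma]
  simp only [Fintype.card_fin]
  rw [Fin.sum_univ_eq_sum_range (fun i => i + 1), Finset.sum_add_distrib, Finset.sum_range_id,
    Finset.sum_const, Finset.card_range, smul_eq_mul, mul_one]
  cases n with
  | zero => rfl
  | succ n =>
    rw [Nat.add_sub_cancel, show (n + 1) * (n + 1 + 1) = (n + 1) * n + (n + 1) * 2 by ring,
      Nat.add_mul_div_right _ _ two_pos]

/-- The generic Hessenberg matrix: variables on and above the diagonal, ones on the subdiagonal. -/
def genericHessenberg (n : ℕ) : Matrix (Fin n) (Fin n) (MvPolynomial (UpperIndex n) ℂ) :=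
  Matrix.of fun i j => if h : i ≤ j then MvPolynomial.X ⟨j, ⟨i, Nat.lt_succ_of_le h⟩⟩
    else if (i : ℕ) = j + 1 then 1 else 0

/-- Restriction of polynomial functions to the Hessenberg matrices. -/
def restrict (n : ℕ) : P n →ₐ[ℂ] MvPolynomial (UpperIndex n) ℂ :=
  MvPolynomial.aeval fun a => genericHessenberg n a.1 a.2

theorem eval_restrict {n : ℕ} (f : P n) {x : Matrix (Fin n) (Fin n) ℂ} (hx : IsHessenberg n x) :
    MvPolynomial.eval (fun t : UpperIndex n => x (Fin.castLE t.1.2 t.2) t.1) (restrict n f) =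
      value f x := by
  have : (MvPolynomial.aeval fun t : UpperIndex n => x (Fin.castLE t.1.2 t.2) t.1).comp
      (restrict n) = MvPolynomial.aeval fun a : Fin n × Fin n => x a.1 a.2 := by
    refine MvPolynomial.algHom_ext fun a => ?_
    simp only [restrict, AlgHom.comp_apply, MvPolynomial.aeval_X, genericHessenberg,
      Matrix.of_apply]
    split_ifs with h1 h2
    · simp
    · rw [map_one, hx _ _ a.1.2 (not_le.1 h1), if_pos h2]
    · rw [map_zero, hx _ _ a.1.2 (not_le.1 h1), if_neg h2]
  exact DFunLike.congr_fun this f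

/-- The generators of `J n`: the coefficients, except the leading ones, of the characteristic
polynomials of the blocks. -/
def blockCoeff (n : ℕ) (t : UpperIndex n) : P n :=
  embed (Nat.succ_le_of_lt t.1.2) (charCoeff (t.1 + 1) t.2)

theorem blockCoeff_mem_J {n : ℕ} (t : UpperIndex n) : blockCoeff n t ∈ J n :=
  embed_mem_J (Nat.succ_pos _) _ (charCoeff_mem_invariants _ _)

theorem restrict_embed_charCoeff {m n : ℕ} (h : m ≤ n) (k : ℕ) :
    restrict n (embed h (charCoeff m k)) = (block h (genericHessenberg n)).charpoly.coeff k := by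
  have h1 : ((restrict n).comp (embed h) : P m →+* _).mapMatrix
      (Matrix.mvPolynomialX (Fin m) (Fin m) ℂ) = block h (genericHessenberg n) := by
    ext1 i j
    simp [restrict, embed, block]
  rw [← h1, RingHom.mapMatrix_apply, Matrix.charpoly_map, Polynomial.coeff_map]
  rfl

/-- The coordinates of a Hessenberg matrix are polynomials in the values of the generators. -/
theorem adjoin_restrict_blockCoeff (n : ℕ) :
    Algebra.adjoin ℂ (Set.range fun t => restrict n (blockCoeff n t)) = ⊤ := by
  set S := Algebra.adjoin ℂ (Set.range fun t => restrict n (blockCoeff n t)) with hS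
  have hx : ∀ i j : Fin n, j < i → genericHessenberg n i j = if (i : ℕ) = j + 1 then 1 else 0 := by
    intro i j hij
    rw [genericHessenberg, Matrix.of_apply, dif_neg (not_le.2 hij)]
  have hcoeff : ∀ (m : ℕ) (h : m ≤ n) (k : ℕ),
      (block h (genericHessenberg n)).charpoly.coeff k ∈ S := by
    intro m h k
    have hdeg := Matrix.charpoly_natDegree_eq_dim (block h (genericHessenberg n))
    rw [Fintype.card_fin] at hdeg
    rcases lt_trichotomy k m with hk | rfl | hk
    · obtain ⟨m, rfl⟩ := Nat.exists_eq_succ_of_ne_zero (Nat.ne_of_gt (Nat.zero_lt_of_lt hk))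
      rw [← restrict_embed_charCoeff]
      exact Algebra.subset_adjoin ⟨⟨⟨m, h⟩, ⟨k, hk⟩⟩, rfl⟩
    · have := Matrix.charpoly_monic (block h (genericHessenberg n))
      rw [Polynomial.Monic, Polynomial.leadingCoeff, hdeg] at this
      rw [this]
      exact S.one_mem
    · rw [Polynomial.coeff_eq_zero_of_natDegree_lt (hdeg.trans_lt hk)]
      exact S.zero_mem
  rw [eq_top_iff, ← MvPolynomial.adjoin_range_X]
  refine Algebra.adjoin_le ?_
  rintro _ ⟨⟨j, i⟩, rfl⟩
  have hij : Fin.castLE j.2 i ≤ j := Nat.le_of_lt_succ i.2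
  have := mem_of_charpoly_coeff_mem hx S hcoeff _ _ hij
  rw [genericHessenberg, Matrix.of_apply, dif_pos hij] at this
  exact this

/-- As many generators of a polynomial ring as there are variables are algebraically independent. -/
theorem algebraicIndependent_of_adjoin_eq_top {ι : Type} [Finite ι] {y : ι → MvPolynomial ι ℂ}
    (h : Algebra.adjoin ℂ (Set.range y) = ⊤) : AlgebraicIndependent ℂ y := by
  have : Algebra.IsAlgebraic (Algebra.adjoin ℂ (Set.range y)) (MvPolynomial ι ℂ) :=
    ⟨fun a => isAlgebraic_algebraMap
      (⟨a, h ▸ Algebra.mem_top⟩ : Algebra.adjoin ℂ (Set.range y))⟩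
  have hcard : Cardinal.mk ι ≤ Algebra.trdeg ℂ (MvPolynomial ι ℂ) := by
    rw [MvPolynomial.trdeg_of_isDomain, Cardinal.lift_id]
  exact (Algebra.IsAlgebraic.isTranscendenceBasis_of_le_trdeg_of_finite ℂ y hcard).1

theorem algebraicIndependent_blockCoeff (n : ℕ) : AlgebraicIndependent ℂ (blockCoeff n) :=
  .of_comp (restrict n) (algebraicIndependent_of_adjoin_eq_top (adjoin_restrict_blockCoeff n))

/-- A function that Poisson commutes with `J n` is a polynomial in the generators: it agrees with
such a polynomial on the Hessenberg matrices, hence everywhere. -/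
theorem mem_adjoin_of_poisson_eq_zero {n : ℕ} {f : P n} (hf : ∀ q ∈ J n, poisson f q = 0) :
    f ∈ Algebra.adjoin ℂ (Set.range (blockCoeff n)) := by
  have hJ : Algebra.adjoin ℂ (Set.range (blockCoeff n)) ≤ J n := by
    refine Algebra.adjoin_le ?_
    rintro _ ⟨t, rfl⟩
    exact blockCoeff_mem_J t
  have hmap : (Algebra.adjoin ℂ (Set.range (blockCoeff n))).map (restrict n) = ⊤ := by
    rw [AlgHom.map_adjoin, ← Set.range_comp]
    exact adjoin_restrict_blockCoeff n
  obtain ⟨g, hg, hgf⟩ : restrict n f ∈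
      (Algebra.adjoin ℂ (Set.range (blockCoeff n))).map (restrict n) := hmap ▸ Algebra.mem_top
  have h0 : f - g = 0 := by
    refine eq_zero_of_value_hessenberg (fun q hq => ?_) fun x hx => ?_
    · exact (commutant q).sub_mem (hf q hq) (isPoissonCommutative_J n g (hJ hg) q hq)
    · rw [← eval_restrict _ hx, map_sub, show restrict n g = restrict n f from hgf, sub_self,
        map_zero]
  rwa [sub_eq_zero.1 h0]

theorem adjoin_blockCoeff (n : ℕ) : Algebra.adjoin ℂ (Set.range (blockCoeff n)) = J n := by
  refine le_antisymm (Algebra.adjoin_le ?_) fun f hf =>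
    mem_adjoin_of_poisson_eq_zero (isPoissonCommutative_J n f hf)
  rintro _ ⟨t, rfl⟩
  exact blockCoeff_mem_J t

end GelfandZeitlin

end

theorem theorem3p25 (n : ℕ) (hn : 1 ≤ n) :
    (∃ p : Fin (n * (n + 1) / 2) → GelfandZeitlin.P n,
      AlgebraicIndependent ℂ p ∧
        Algebra.adjoin ℂ (Set.range p) = GelfandZeitlin.J n) ∧
    Maximal (fun A : Subalgebra ℂ (GelfandZeitlin.P n) =>
      GelfandZeitlin.IsPoissonCommutative A) (GelfandZeitlin.J n) := by
  refine ⟨?_, GelfandZeitlin.isPoissonCommutative_J n, fun A hA hJA f hf => ?_⟩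
  · let e := Fintype.equivFinOfCardEq (GelfandZeitlin.card_upperIndex n)
    refine ⟨GelfandZeitlin.blockCoeff n ∘ e.symm,
      (GelfandZeitlin.algebraicIndependent_blockCoeff n).comp _ e.symm.injective, ?_⟩
    rw [e.symm.surjective.range_comp, GelfandZeitlin.adjoin_blockCoeff]
  · rw [← GelfandZeitlin.adjoin_blockCoeff]
    exact GelfandZeitlin.mem_adjoin_of_poisson_eq_zero fun q hq => hA f hf q (hJA hq)
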